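/- \textbf{Notation.} Let $2^{<\omega}$ be the set of finite binary strings and $2^\omega$ the set of infinite binary sequences, $\preceq$ the prefix relation, $X{\upharpoonright}n$ the prefix of $X$ of length $n$, and $\mu$ the uniform (Lebesgue) measure on $2^\omega$. Fix the standard effective enumeration $(\mathcal W_e)_{e\in\omega}$ of all effectively open subsets of $2^\omega$, where $\mathcal W_e$ is the set of all $X\in 2^\omega$ having a prefix in the $e$-th c.e. set of strings. Let $\emptyset'$ be the halting problem. A \emph{Demuth test} is a sequence $(\mathcal W_{g(n)})_{n\in\omega}$ such that $\mu(\mathcal W_{g(n)})\le 2^{-n}$ for all $n$, where $g:\omega\to\omega$ is $\omega$-c.a.: there are computable functions $a:\omega\times\omega\to\omega$ and $h:\omega\to\omega$ such that for every $n$, $\lim_s a(n,s)=g(n)$ and there are at most $h(n)$ many $s$ with $a(n,s)\ne a(n,s+1)$. A sequence $X\in 2^\omega$ is \emph{Demuth random} if for every Demuth test $(\mathcal W_{g(n)})_{n\in\omega}$ there are only finitely many $n$ with $X\in\mathcal W_{g(n)}$. A sequence $G\in 2^\omega$ is \emph{pb-generic} if for every function $f:2^{<\omega}\to2^{<\omega}$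 such that (i) $f$ is computable from the oracle $\emptyset'$ by a Turing functional which on each input $\sigma$ queries the oracle only below $u(\sigma)$, for some primitive recursive function $u$, and (ii) $\sigma\preceq f(\sigma)$ for all $\sigma$, there are infinitely many $n$ such that $f(G{\upharpoonright}n)\preceq G$. \textbf{Theorem.} If $X\in 2^\omega$ is Demuth random and $G\in 2^\omega$ is pb-generic, then $X$ and $G$ form a minimal pair in the Turing degrees; that is, neither $X$ nor $G$ is computable, and every sequence $Z\in 2^\omega$ that is computable both from $X$ and from $G$ is computable. -/

import Mathlib

open MeasureTheory Encodable
open scoped ENNReal Computability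

namespace MinPair

/-! ### Cantor space and strings -/

/-- Cantor space: infinite binary sequences. Finite strings are `List Bool`. -/
abbrev Cantor : Type := ℕ → Bool

/-- The prefix of length `n` of an infinite sequence. -/
def restr (X : Cantor) (n : ℕ) : List Bool := (List.range n).map X

/-- The finite string `σ` is a prefix of the infinite sequence `X`. -/
def IsPrefixOf (σ : List Bool) (X : Cantor) : Prop := restr X σ.length = σ

/-- The uniform (Lebesgue) measure on Cantor space: the law of independent fair bits. -/
noncomputable def lebesgue : Measure Cantor :=
  Measure.infinitePi fun _ : ℕ => (PMF.uniformOfFintype Bool).toMeasure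

/-! ### Relative computability -/

/-- The characteristic function of `X`, as a total `0`/`1`-valued oracle. -/
def oracle (X : Cantor) : ℕ →. ℕ := fun n => Part.some (X n).toNat

/-- `Z` is Turing reducible to `X`. -/
def Reducible (Z X : Cantor) : Prop := oracle Z ≤ᵀ oracle X

/-- `X` and `Y` form a minimal pair in the Turing degrees: both are noncomputable, and every
sequence computable from both is computable. -/
def IsMinimalPair (X Y : Cantor) : Prop :=
  ¬ Computable X ∧ ¬ Computable Y ∧
    ∀ Z : Cantor, Reducible Z X → Reducible Z Y → Computable Z

/-- Programs for oracle computations: the codes `Nat.Partrec.Code` together with an instruction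
that queries the oracle. -/
inductive OracleCode : Type
  | zero : OracleCode
  | succ : OracleCode
  | left : OracleCode
  | right : OracleCode
  | query : OracleCode
  | pair : OracleCode → OracleCode → OracleCode
  | comp : OracleCode → OracleCode → OracleCode
  | prec : OracleCode → OracleCode → OracleCode
  | rfind : OracleCode → OracleCode

/-- The Turing functional given by an oracle program. The oracle is allowed to be partial;
a computation that queries the oracle outside its domain diverges. -/
def OracleCode.eval (O : ℕ →. ℕ) : OracleCode → ℕ →. ℕ
  | .zero => fun _ => 0
  | .succ => Nat.succ
  | .left => fun n => (Nat.unpair n).1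
  | .right => fun n => (Nat.unpair n).2
  | .query => O
  | .pair c d => fun n => Nat.pair <$> c.eval O n <*> d.eval O n
  | .comp c d => fun n => d.eval O n >>= c.eval O
  | .prec c d => fun p =>
      let (a, n) := Nat.unpair p
      n.rec (c.eval O a) fun y IH => do
        let i ← IH
        d.eval O (Nat.pair a (Nat.pair y i))
  | .rfind c => fun a => Nat.rfind fun n => (fun m => m = 0) <$> c.eval O (Nat.pair a n)

/-- Oracle programs compute exactly the functions that are partial recursive in the oracle. -/
theorem OracleCode.exists_eval_iff (O f : ℕ →. ℕ) :
    (∃ c : OracleCode, c.eval O = f) ↔ f ≤ᵀ O := by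
  rw [TuringReducible, RecursiveIn.iff_nat]
  constructor
  · rintro ⟨c, rfl⟩
    induction c with
    | zero => exact .zero
    | succ => exact .succ
    | left => exact .left
    | right => exact .right
    | query => exact .oracle _ rfl
    | pair _ _ h₁ h₂ => exact .pair h₁ h₂
    | comp _ _ h₁ h₂ => exact .comp h₁ h₂
    | prec _ _ h₁ h₂ => exact .prec h₁ h₂
    | rfind _ h => exact .rfind h
  · intro h
    induction h with
    | zero => exact ⟨.zero, rfl⟩
    | succ => exact ⟨.succ, rfl⟩
    | left => exact ⟨.left, rfl⟩
    | right => exact ⟨.right, rfl⟩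
    | oracle g hg => exact ⟨.query, hg.symm⟩
    | pair _ _ h₁ h₂ =>
      obtain ⟨c, rfl⟩ := h₁
      obtain ⟨d, rfl⟩ := h₂
      exact ⟨.pair c d, rfl⟩
    | comp _ _ h₁ h₂ =>
      obtain ⟨c, rfl⟩ := h₁
      obtain ⟨d, rfl⟩ := h₂
      exact ⟨.comp c d, rfl⟩
    | prec _ _ h₁ h₂ =>
      obtain ⟨c, rfl⟩ := h₁
      obtain ⟨d, rfl⟩ := h₂
      exact ⟨.prec c d, rfl⟩
    | rfind _ h =>
      obtain ⟨c, rfl⟩ := h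
      exact ⟨.rfind c, rfl⟩

/-- The oracle `X` cut off at `u`: only queries below `u` are answered. -/
def oracleBelow (X : Cantor) (u : ℕ) : ℕ →. ℕ :=
  fun n => if n < u then Part.some (X n).toNat else Part.none

open Classical in
/-- The halting problem `∅'`, i.e. `{e | φ_e(e) halts}`, as a sequence. -/
noncomputable def jumpZero : Cantor :=
  fun e => decide ((Nat.Partrec.Code.eval (Denumerable.ofNat Nat.Partrec.Code e) e).Dom)

/-- `f` is computable in `∅'` with a primitive recursive bound on the use: some oracle program
computes `f` from `∅'` and, on each input `σ`, queries the oracle only at numbers below `u σ`,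
where `u` is primitive recursive. -/
def PbComputable (f : List Bool → List Bool) : Prop :=
  ∃ (c : OracleCode) (u : List Bool → ℕ), Primrec u ∧
    ∀ σ, c.eval (oracleBelow jumpZero (u σ)) (encode σ) = Part.some (encode (f σ))

/-- `G` is pb-generic. -/
def IsPbGeneric (G : Cantor) : Prop :=
  ∀ f : List Bool → List Bool, PbComputable f → (∀ σ, σ <+: f σ) →
    {n : ℕ | IsPrefixOf (f (restr G n)) G}.Infinite

/-! ### Demuth randomness -/

/-- The `e`-th effectively open set: the union of the cylinders `[σ]` over the strings `σ` in the
`e`-th computably enumerable set of strings (the domain of the `e`-th partial recursive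
function). -/
def effOpen (e : ℕ) : Set Cantor :=
  {X | ∃ σ : List Bool,
    (Nat.Partrec.Code.eval (Denumerable.ofNat Nat.Partrec.Code e) (encode σ)).Dom ∧
      IsPrefixOf σ X}

/-- `g` is `ω`-c.a.: it has a computable approximation whose number of mind changes at `n` is at
most `h n`, for some computable function `h`. -/
def IsOmegaCA (g : ℕ → ℕ) : Prop :=
  ∃ (a : ℕ → ℕ → ℕ) (h : ℕ → ℕ), Computable₂ a ∧ Computable h ∧
    ∀ n, {s | a n s ≠ a n (s + 1)}.encard ≤ h n ∧ ∀ᶠ s in Filter.atTop, a n s = g n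

/-- `g` gives a Demuth test, namely the sequence of the sets `effOpen (g n)`. -/
def IsDemuthTest (g : ℕ → ℕ) : Prop :=
  IsOmegaCA g ∧ ∀ n, lebesgue (effOpen (g n)) ≤ (2 : ℝ≥0∞)⁻¹ ^ n

/-- `X` is Demuth random: it lies in only finitely many levels of every Demuth test. -/
def IsDemuthRandom (X : Cantor) : Prop :=
  ∀ g : ℕ → ℕ, IsDemuthTest g → {n | X ∈ effOpen (g n)}.Finite

end MinPair

/-! Suppose a noncomputable `Z` is computed from `G` by `Γ` and from `X` by `Ψ`. Since `Z` is not
computable, the extensions of any prefix of `G` have arbitrarily many pairwise incompatible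
`Γ`-images (`exists_splitting_family`). Incompatible images have disjoint `Ψ`-preimages, so among `2
^ encode σ + 1` of them at least one has preimage of measure at most `2 ^ (-encode σ)`
(`exists_not_isLarge`).

For each `σ`, ask `∅'` whether such a family of extensions can be found, and which members of the
family have too large a preimage. Both are c.e. questions, and a primitive recursive bound on the
queries is known in advance. Let `f σ` be the extension belonging to the first image `η` with small
preimage, and let level `encode σ` of a test be the `Ψ`-preimage of `η`. Then `f` is admissible for
pb-genericity. The index of the level is read off from a bounded initial segment of `∅'`, so its
mind changes are computably bounded and the test is a Demuth test.

Whenever `f (G↾n)` is a prefix of `G`, the image `η` is a prefix of `Z`, so `X` lies in level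
`encode (G↾n)`. Genericity makes this happen for infinitely many `n`, which contradicts Demuth
randomness.

Noncomputability of `X` and of `G` is separate and direct: a computable `X` is caught by its own
cylinders, and a computable `G` is avoided by flipping its next bit. -/

namespace MinPair

/-! ### Closure properties of c.e. predicates, uniformization and indices -/

section REPred

theorem assert_unit_dom (p : Prop) : (Part.assert p fun _ => Part.some ()).Dom ↔ p := by
  simp [Part.dom_iff_mem]

variable {α β γ : Type*} [Primcodable α] [Primcodable β] [Primcodable γ]

theorem _root_.REPred.exists_code {p : α → Prop} (hp : REPred p) :
    ∃ c : Nat.Partrec.Code, ∀ a, (c.eval (encode a)).Dom ↔ p a := by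
  obtain ⟨c, hc⟩ := Nat.Partrec.Code.exists_code.1 hp
  refine ⟨c, fun a => ?_⟩
  rw [hc]
  simp [assert_unit_dom]

theorem _root_.REPred.comp {p : β → Prop} (hp : REPred p) {f : α → β} (hf : Computable f) :
    REPred fun a => p (f a) :=
  Partrec.comp hp hf

theorem _root_.REPred.and {p q : α → Prop} (hp : REPred p) (hq : REPred q) :
    REPred fun a => p a ∧ q a := by
  refine (Partrec.dom_re (Partrec.bind hp (Partrec.comp hq Computable.fst).to₂)).of_eq fun a => ?_
  simp [assert_unit_dom]

theorem _root_.REPred.computable_eq [DecidableEq β] {f g : α → β} (hf : Computable f)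
    (hg : Computable g) : REPred fun a => f a = g a :=
  REPred.comp (p := fun q : β × β => q.1 = q.2)
    (Primrec.eq (α := β)).computablePred.to_re (hf.pair hg)

theorem _root_.REPred.computable_lt {f g : α → ℕ} (hf : Computable f)
    (hg : Computable g) : REPred fun a => f a < g a :=
  REPred.comp (p := fun q : ℕ × ℕ => q.1 < q.2) Primrec.nat_lt.computablePred.to_re (hf.pair hg)

/-- Effective selection: a computably enumerable relation has a partial computable choice
function. -/
theorem _root_.REPred.exists_selection {R : α × β → Prop} (hR : REPred R) :
    ∃ h : α →. β, Partrec h ∧ (∀ a, ∀ b ∈ h a, R (a, b)) ∧ ∀ a b, R (a, b) → (h a).Dom := by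
  obtain ⟨c, hc⟩ := hR.exists_code
  -- Dovetailing: `k` codes a candidate witness together with a step bound.
  let t : α → ℕ → Option β := fun a k =>
    (decode (α := β × ℕ) k).bind fun q =>
      (c.evaln q.2 (encode (a, q.1))).map fun _ => q.1
  have ht : Computable₂ t := by
    have : Primrec fun p : (α × ℕ) × (β × ℕ) =>
        (c.evaln p.2.2 (encode (p.1.1, p.2.1))).map fun _ => p.2.1 :=
      Primrec.option_map (Nat.Partrec.Code.primrec_evaln.comp
        (((Primrec.snd.comp .snd).pair (.const c)).pair
          (Primrec.encode.comp ((Primrec.fst.comp .fst).pair (Primrec.fst.comp .snd)))))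
        (Primrec.fst.comp (Primrec.snd.comp .fst)).to₂
    exact (Primrec.option_bind (Primrec.decode.comp .snd) this.to₂).to_comp
  refine ⟨fun a => Nat.rfindOpt (t a), Partrec.rfindOpt ht, fun a b hb => ?_, fun a b hab => ?_⟩
  · obtain ⟨k, hk⟩ := Nat.rfindOpt_spec hb
    simp only [t, Option.mem_def, Option.bind_eq_some_iff, Option.map_eq_some_iff] at hk
    obtain ⟨q, -, y, hy, rfl⟩ := hk
    exact (hc _).1 (Part.dom_iff_mem.2 ⟨y, Nat.Partrec.Code.evaln_sound hy⟩)
  · obtain ⟨y, hy⟩ := Part.dom_iff_mem.1 ((hc _).2 hab)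
    obtain ⟨k, hk⟩ := Nat.Partrec.Code.evaln_complete.1 hy
    refine Nat.rfindOpt_dom.2 ⟨encode (b, k), b, ?_⟩
    rw [Option.mem_def] at hk
    simp only [t, encodek, Option.bind_some, hk, Option.map_some, Option.mem_def]

theorem _root_.REPred.exists {R : α × β → Prop} (hR : REPred R) : REPred fun a => ∃ b, R (a, b) := by
  obtain ⟨h, hh, h₁, h₂⟩ := hR.exists_selection
  refine (Partrec.dom_re hh).of_eq fun a => ⟨fun ha => ?_, fun ⟨b, hb⟩ => h₂ a b hb⟩
  exact ⟨(h a).get ha, h₁ a _ (Part.get_mem ha)⟩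

theorem _root_.REPred.mem_graph [DecidableEq β] {f : α →. β} (hf : Partrec f) :
    REPred fun p : α × β => p.2 ∈ f p.1 := by
  have : REPred fun q : (α × β) × β => q.2 = q.1.2 :=
    REPred.computable_eq .snd (Computable.snd.comp .fst)
  refine (Partrec.dom_re (Partrec.bind (hf.comp .fst) (Partrec.to₂ this))).of_eq fun p => ?_
  simp only [Part.dom_iff_mem, Part.mem_bind_iff, Part.mem_assert_iff]
  constructor
  · rintro ⟨_, b, hb, rfl, -⟩
    exact hb
  · exact fun h => ⟨(), _, h, rfl, by simp⟩

theorem _root_.REPred.mem_of_partrec [DecidableEq β] {f : α →. β} (hf : Partrec f) {g : α → β}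
    (hg : Computable g) : REPred fun a => g a ∈ f a :=
  (REPred.mem_graph hf).comp (Computable.id.pair hg)

/-- Running the semidecision procedures for `m = 0, 1, ...` one after another halts exactly when all
of them halt. -/
theorem _root_.REPred.forall_lt {P : α × ℕ → Prop} (hP : REPred P) {f : α → ℕ} (hf : Computable f) :
    REPred fun a => ∀ m < f a, P (a, m) := by
  have key : Partrec fun a => ((f a).rec (Part.some ())
      fun m IH => IH.bind fun _ => Part.assert (P (a, m)) fun _ => Part.some () : Part Unit) :=
    Partrec.nat_rec hf (Computable.const ()).partrec (h := fun a q =>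
      Part.assert (P (a, q.1)) fun _ => Part.some ())
      (Partrec.to₂ (Partrec.comp hP (Computable.fst.pair (Computable.fst.comp .snd))))
  refine (Partrec.dom_re key).of_eq fun a => ?_
  induction f a with
  | zero => simp
  | succ k ih =>
    simp only [Part.bind_dom, assert_unit_dom, exists_prop]
    rw [Nat.forall_lt_succ_right, ← ih]

theorem _root_.REPred.forall_mem_list {P : α × β → Prop} (hP : REPred P) [DecidableEq β]
    {f : α → List β} (hf : Computable f) :
    REPred fun a => ∀ b ∈ f a, P (a, b) := by
  have : REPred fun q : (α × ℕ) × β => (f q.1.1)[q.1.2]? = some q.2 ∧ P (q.1.1, q.2) :=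
    (REPred.computable_eq
      (Computable.list_getElem?.comp (hf.comp (Computable.fst.comp .fst))
        (Computable.snd.comp .fst)) (Computable.option_some.comp .snd)).and
    (hP.comp ((Computable.fst.comp .fst).pair .snd))
  refine (this.exists.forall_lt (Computable.list_length.comp hf)).of_eq fun a => ?_
  constructor
  · intro h b hb
    obtain ⟨i, hi, rfl⟩ := List.getElem_of_mem hb
    obtain ⟨b, hb, h'⟩ := h i hi
    rw [List.getElem?_eq_getElem hi, Option.some_inj] at hb
    exact hb ▸ h'
  · exact fun h i hi => ⟨(f a)[i], List.getElem?_eq_getElem hi, h _ (List.getElem_mem hi)⟩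

theorem _root_.REPred.pairwise_list {P : β × β → Prop} (hP : REPred P) [DecidableEq β] :
    REPred fun l : List β => l.Pairwise fun b b' => P (b, b') := by
  have : REPred fun q : ((List β × ℕ) × ℕ) × β × β =>
      q.1.1.1[q.1.2]? = some q.2.1 ∧ q.1.1.1[q.1.1.2]? = some q.2.2 ∧ P q.2 := by
    have hl : Computable fun q : ((List β × ℕ) × ℕ) × β × β => q.1.1.1 :=
      Computable.fst.comp (Computable.fst.comp .fst)
    refine REPred.and ?_ (REPred.and ?_ (hP.comp .snd))
    · exact REPred.computable_eq (Computable.list_getElem?.comp hl (Computable.snd.comp .fst))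
        (Computable.option_some.comp (Computable.fst.comp .snd))
    · exact REPred.computable_eq
        (Computable.list_getElem?.comp hl (Computable.snd.comp (Computable.fst.comp .fst)))
        (Computable.option_some.comp (Computable.snd.comp .snd))
  refine ((this.exists.forall_lt (f := fun q : List β × ℕ => q.2) .snd).forall_lt
    (Computable.list_length)).of_eq fun l => ?_
  rw [List.pairwise_iff_getElem]
  constructor
  · intro h i j hi hj hij
    obtain ⟨b, hb, hb', h'⟩ := h j hj i hij
    simp only [List.getElem?_eq_getElem hi, List.getElem?_eq_getElem hj, Option.some_inj] at hb hb'
    rw [hb, hb']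
    exact h'
  · exact fun h j hj i hij => ⟨(l[i]'(hij.trans hj), l[j]), List.getElem?_eq_getElem _,
      List.getElem?_eq_getElem _, h i j _ hj hij⟩

/-- The `s`-`m`-`n` theorem for computably enumerable relations. -/
theorem _root_.REPred.exists_index {R : α × β → Prop} (hR : REPred R) :
    ∃ s : α → ℕ, Primrec s ∧ ∀ a b,
      ((Denumerable.ofNat Nat.Partrec.Code (s a)).eval (encode b)).Dom ↔ R (a, b) := by
  obtain ⟨c, hc⟩ := hR.exists_code
  refine ⟨fun a => encode (c.curry (encode a)), ?_, fun a b => ?_⟩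
  · exact Primrec.encode.comp (Nat.Partrec.Code.primrec₂_curry.comp (.const c) .encode)
  · rw [Denumerable.ofNat_encode, Nat.Partrec.Code.eval_curry, ← hc]
    rfl

/-- Every computably enumerable predicate is many-one reducible to the halting problem, by a
primitive recursive function. -/
theorem _root_.REPred.exists_reduction_jumpZero {p : α → Prop} (hp : REPred p) :
    ∃ q : α → ℕ, Primrec q ∧ ∀ a, jumpZero (q a) = true ↔ p a := by
  -- The program `s a` ignores its input, so it halts on its own index exactly when `p a` holds.
  obtain ⟨s, hs, h⟩ := REPred.exists_index (R := fun q : α × ℕ => p q.1) (hp.comp .fst)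
  exact ⟨s, hs, fun a => by simpa [jumpZero] using h a (s a)⟩

end REPred

/-! ### Finite oracles -/

@[simp] theorem length_restr (X : Cantor) (n : ℕ) : (restr X n).length = n := by simp [restr]

theorem getElem?_restr (X : Cantor) {n m : ℕ} (h : m < n) : (restr X n)[m]? = some (X m) := by
  simp [restr, h]

theorem getElem_restr (X : Cantor) {n m : ℕ} (h : m < (restr X n).length) :
    (restr X n)[m] = X m := by
  simp [restr]

theorem restr_succ (X : Cantor) (n : ℕ) : restr X (n + 1) = restr X n ++ [X n] := by
  simp [restr, List.range_succ]

theorem restr_add (X : Cantor) (n k : ℕ) : ∃ ρ, restr X (n + k) = restr X n ++ ρ := by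
  induction k with
  | zero => exact ⟨[], by simp⟩
  | succ k ih =>
    obtain ⟨ρ, h⟩ := ih
    exact ⟨ρ ++ [X (n + k)], by rw [← add_assoc, restr_succ, h, List.append_assoc]⟩

theorem isPrefixOf_restr (X : Cantor) (n : ℕ) : IsPrefixOf (restr X n) X := by
  simp [IsPrefixOf]

theorem IsPrefixOf.getElem {σ : List Bool} {X : Cantor} (h : IsPrefixOf σ X) {m : ℕ}
    (hm : m < σ.length) : σ[m] = X m := by
  have := getElem?_restr X hm
  rw [h, List.getElem?_eq_getElem hm, Option.some_inj] at this
  exact this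

/-- The finite string `σ` as a partial oracle, defined below the length of `σ`. -/
def strOracle (σ : List Bool) : ℕ →. ℕ := fun n => ((σ[n]?).map Bool.toNat : Option ℕ)

theorem mem_strOracle {σ : List Bool} {n v : ℕ} :
    v ∈ strOracle σ n ↔ ∃ b, σ[n]? = some b ∧ b.toNat = v := by
  simp [strOracle]

namespace OracleCode

/-- The result of running an oracle program on an input. -/
def run (O : ℕ →. ℕ) (c : OracleCode) (n : ℕ) : Part ℕ := c.eval O n

theorem run_query (O : ℕ →. ℕ) (n : ℕ) : query.run O n = O n := rfl

theorem run_left (O : ℕ →. ℕ) (n : ℕ) : left.run O n = Part.some (Nat.unpair n).1 := rfl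

theorem run_right (O : ℕ →. ℕ) (n : ℕ) : right.run O n = Part.some (Nat.unpair n).2 := rfl

theorem run_pair (O : ℕ →. ℕ) (c d : OracleCode) (n : ℕ) :
    (pair c d).run O n = (c.run O n).bind fun a => (d.run O n).map fun b => Nat.pair a b := by
  change ((c.run O n).map Nat.pair).bind (fun g => (d.run O n).map g) = _
  rw [Part.bind_map]

theorem run_comp (O : ℕ →. ℕ) (c d : OracleCode) (n : ℕ) :
    (comp c d).run O n = (d.run O n).bind fun a => c.run O a :=
  rfl

theorem run_prec (O : ℕ →. ℕ) (c d : OracleCode) (p : ℕ) :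
    (prec c d).run O p = (Nat.unpair p).2.rec (c.run O (Nat.unpair p).1) fun y IH =>
      IH.bind fun i => d.run O (Nat.pair (Nat.unpair p).1 (Nat.pair y i)) :=
  rfl

theorem run_prec_zero (O : ℕ →. ℕ) (c d : OracleCode) (a : ℕ) :
    (prec c d).run O (Nat.pair a 0) = c.run O a := by
  rw [run_prec, Nat.unpair_pair]
  rfl

theorem run_prec_succ (O : ℕ →. ℕ) (c d : OracleCode) (a k : ℕ) :
    (prec c d).run O (Nat.pair a (k + 1)) =
      ((prec c d).run O (Nat.pair a k)).bind fun i => d.run O (Nat.pair a (Nat.pair k i)) := by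
  rw [run_prec, run_prec, Nat.unpair_pair, Nat.unpair_pair]

theorem run_rfind (O : ℕ →. ℕ) (c : OracleCode) (n : ℕ) :
    (rfind c).run O n = Nat.rfind fun m => (c.run O (Nat.pair n m)).map fun a => decide (a = 0) :=
  rfl

theorem mem_run_rfind {O : ℕ →. ℕ} {c : OracleCode} {n v : ℕ} :
    v ∈ (rfind c).run O n ↔ (∃ a ∈ c.run O (Nat.pair n v), decide (a = 0) = true) ∧
      ∀ m < v, ∃ a ∈ c.run O (Nat.pair n m), decide (a = 0) = false := by
  refine Nat.mem_rfind.trans ?_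
  exact and_congr (Part.mem_map_iff _) (forall₂_congr fun _ _ => Part.mem_map_iff _)

/-- An unanswered query diverges, so a convergent computation sees only answers that the larger
oracle shares. -/
theorem run_mono {O O' : ℕ →. ℕ} (h : ∀ n, ∀ v ∈ O n, v ∈ O' n) (c : OracleCode) {n v : ℕ}
    (hv : v ∈ c.run O n) : v ∈ c.run O' n := by
  induction c generalizing n v with
  | zero | succ | left | right => exact hv
  | query => exact h n v hv
  | pair c d hc hd =>
    simp only [run_pair, Part.mem_bind_iff, Part.mem_map_iff] at hv ⊢
    obtain ⟨a, ha, b, hb, rfl⟩ := hv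
    exact ⟨a, hc ha, b, hd hb, rfl⟩
  | comp c d hc hd =>
    simp only [run_comp, Part.mem_bind_iff] at hv ⊢
    obtain ⟨a, ha, hb⟩ := hv
    exact ⟨a, hd ha, hc hb⟩
  | prec c d hc hd =>
    rw [← Nat.pair_unpair n] at hv ⊢
    generalize (Nat.unpair n).2 = k at hv ⊢
    induction k generalizing v with
    | zero =>
      rw [run_prec_zero] at hv ⊢
      exact hc hv
    | succ k ih =>
      simp only [run_prec_succ, Part.mem_bind_iff] at hv ⊢
      obtain ⟨a, ha, hb⟩ := hv
      exact ⟨a, ih ha, hd hb⟩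
  | rfind c hc =>
    rw [mem_run_rfind] at hv ⊢
    obtain ⟨⟨a, ha, ha'⟩, hb⟩ := hv
    refine ⟨⟨a, hc ha, ha'⟩, fun m hm => ?_⟩
    obtain ⟨b, hb, hb'⟩ := hb m hm
    exact ⟨b, hc hb, hb'⟩

/-- A convergent oracle computation uses only a finite part of the oracle. -/
theorem eventually_mem_run {X : Cantor} (c : OracleCode) {n v : ℕ}
    (hv : v ∈ c.run (oracle X) n) :
    ∀ᶠ k in Filter.atTop, v ∈ c.run (strOracle (restr X k)) n := by
  induction c generalizing n v with
  | zero | succ | left | right => exact .of_forall fun _ => hv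
  | query =>
    filter_upwards [Filter.eventually_gt_atTop n] with k hk
    simp only [run_query, oracle, Part.mem_some_iff] at hv ⊢
    exact mem_strOracle.2 ⟨_, getElem?_restr X hk, hv.symm⟩
  | pair c d hc hd =>
    simp only [run_pair, Part.mem_bind_iff, Part.mem_map_iff] at hv ⊢
    obtain ⟨a, ha, b, hb, rfl⟩ := hv
    filter_upwards [hc ha, hd hb] with k h₁ h₂
    exact ⟨a, h₁, b, h₂, rfl⟩
  | comp c d hc hd =>
    simp only [run_comp, Part.mem_bind_iff] at hv ⊢
    obtain ⟨a, ha, hb⟩ := hv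
    filter_upwards [hd ha, hc hb] with k h₁ h₂
    exact ⟨a, h₁, h₂⟩
  | prec c d hc hd =>
    rw [← Nat.pair_unpair n] at hv ⊢
    generalize (Nat.unpair n).2 = k at hv ⊢
    induction k generalizing v with
    | zero =>
      simp only [run_prec_zero] at hv ⊢
      exact hc hv
    | succ k ih =>
      simp only [run_prec_succ, Part.mem_bind_iff] at hv ⊢
      obtain ⟨a, ha, hb⟩ := hv
      filter_upwards [ih ha, hd hb] with k h₁ h₂
      exact ⟨a, h₁, h₂⟩
  | rfind c hc =>
    simp only [mem_run_rfind] at hv ⊢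
    obtain ⟨⟨a, ha, ha'⟩, hb⟩ := hv
    have : ∀ᶠ k in Filter.atTop, ∀ m ∈ Finset.range v,
        ∃ b ∈ c.run (strOracle (restr X k)) (Nat.pair n m), decide (b = 0) = false := by
      rw [Filter.eventually_all_finset]
      intro m hm
      obtain ⟨b, hb, hb'⟩ := hb m (Finset.mem_range.1 hm)
      filter_upwards [hc hb] with k h
      exact ⟨b, h, hb'⟩
    filter_upwards [hc ha, this] with k h₁ h₂
    exact ⟨⟨a, h₁, ha'⟩, fun m hm => h₂ m (Finset.mem_range.2 hm)⟩

theorem partrec_run_strOracle (c : OracleCode) :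
    Partrec fun p : List Bool × ℕ => c.run (strOracle p.1) p.2 := by
  induction c with
  | zero => exact (Computable.const 0).partrec
  | succ => exact (Computable.succ.comp .snd).partrec
  | left => exact (Computable.fst.comp (Computable.unpair.comp .snd)).partrec
  | right => exact (Computable.snd.comp (Computable.unpair.comp .snd)).partrec
  | query =>
    exact Computable.ofOption (Computable.option_map
      (Computable.list_getElem?.comp .fst .snd)
      (((Primrec.dom_finite Bool.toNat).to_comp.comp .snd).to₂))
  | pair c d hc hd =>
    refine Partrec.of_eq ?_ fun p => (run_pair (strOracle p.1) c d p.2).symm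
    exact hc.bind (Partrec.map (hd.comp .fst)
      (Primrec₂.natPair.to_comp.comp (Computable.snd.comp .fst) .snd).to₂).to₂
  | comp c d hc hd =>
    exact hd.bind (hc.comp ((Computable.fst.comp .fst).pair .snd)).to₂
  | prec c d hc hd =>
    have hu : Computable fun p : List Bool × ℕ => Nat.unpair p.2 := Computable.unpair.comp .snd
    have ha : Computable fun q : (List Bool × ℕ) × ℕ × ℕ =>
        Nat.pair (Nat.unpair q.1.2).1 (Nat.pair q.2.1 q.2.2) :=
      Primrec₂.natPair.to_comp.comp (Computable.fst.comp (hu.comp .fst))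
        (Primrec₂.natPair.to_comp.comp (Computable.fst.comp .snd) (Computable.snd.comp .snd))
    have hd' : Partrec fun q : (List Bool × ℕ) × ℕ × ℕ =>
        d.run (strOracle q.1.1) (Nat.pair (Nat.unpair q.1.2).1 (Nat.pair q.2.1 q.2.2)) :=
      hd.comp ((Computable.fst.comp .fst).pair ha)
    have hc' : Partrec fun p : List Bool × ℕ => c.run (strOracle p.1) (Nat.unpair p.2).1 :=
      hc.comp (Computable.fst.pair (Computable.fst.comp hu))
    simp only [run_prec]
    exact Partrec.nat_rec (Computable.snd.comp hu) hc' hd'.to₂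
  | rfind c hc =>
    simp only [run_rfind]
    have ha : Computable fun q : (List Bool × ℕ) × ℕ => (q.1.1, Nat.pair q.1.2 q.2) :=
      (Computable.fst.comp .fst).pair
        (Primrec₂.natPair.to_comp.comp (Computable.snd.comp .fst) .snd)
    have hz : Computable fun m : ℕ => decide (m = 0) :=
      (Primrec.eq.decide.comp .id (.const 0)).to_comp
    have hp : Partrec fun q : (List Bool × ℕ) × ℕ =>
        (c.run (strOracle q.1.1) (Nat.pair q.1.2 q.2)).map fun m => decide (m = 0) :=
      Partrec.map (hc.comp ha) (hz.comp .snd).to₂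
    exact Partrec.rfind hp.to₂

/-- Every partial recursive function is computed by an oracle program that makes no queries. -/
theorem exists_run_eq {f : ℕ →. ℕ} (hf : Nat.Partrec f) :
    ∃ c : OracleCode, ∀ O n, c.run O n = f n := by
  induction hf with
  | zero => exact ⟨.zero, fun _ _ => rfl⟩
  | succ => exact ⟨.succ, fun _ _ => rfl⟩
  | left => exact ⟨.left, fun _ _ => rfl⟩
  | right => exact ⟨.right, fun _ _ => rfl⟩
  | @pair f g _ _ hc hd =>
    obtain ⟨⟨c, hc⟩, d, hd⟩ := And.intro hc hd
    refine ⟨.pair c d, fun O n => ?_⟩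
    change ((c.run O n).map Nat.pair).bind (fun h => (d.run O n).map h) = _
    rw [hc, hd]
    rfl
  | comp _ _ hc hd =>
    obtain ⟨⟨c, hc⟩, d, hd⟩ := And.intro hc hd
    refine ⟨.comp c d, fun O n => ?_⟩
    simp only [run_comp, hc, hd]
    rfl
  | prec _ _ hc hd =>
    obtain ⟨⟨c, hc⟩, d, hd⟩ := And.intro hc hd
    refine ⟨.prec c d, fun O n => ?_⟩
    simp only [run_prec, hc, hd]
    rfl
  | rfind _ hc =>
    obtain ⟨c, hc⟩ := hc
    refine ⟨.rfind c, fun O n => ?_⟩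
    simp only [run_rfind, hc]
    rfl

end OracleCode

/-- A function computed by a partial recursive procedure from a primitive recursively bounded
initial segment of the halting problem is `PbComputable`. -/
theorem PbComputable.of_restr {f : List Bool → List Bool} {F : List Bool × List Bool →. List Bool}
    (hF : Partrec F) {u : List Bool → ℕ} (hu : Primrec u)
    (h : ∀ σ, f σ ∈ F (σ, restr jumpZero (u σ))) : PbComputable f := by
  obtain ⟨cF, hcF⟩ := OracleCode.exists_run_eq hF
  obtain ⟨cu, hcu⟩ := OracleCode.exists_run_eq (Partrec.nat_iff.1
    (Computable.ofOption (f := fun n => (decode (α := List Bool) n).map u)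
      (Computable.option_map .decode (hu.to_comp.comp .snd).to₂)))
  obtain ⟨cid, hcid⟩ := OracleCode.exists_run_eq (Partrec.nat_iff.1
    (Computable.id (α := ℕ)).partrec)
  obtain ⟨cnil, hcnil⟩ := OracleCode.exists_run_eq (Partrec.nat_iff.1
    (Computable.const (α := ℕ) (encode ([] : List Bool))).partrec)
  have hg : Computable fun p : ℕ =>
      (((decode (α := List Bool) (Nat.unpair (Nat.unpair (Nat.unpair p).1).2).2).map
        fun l => encode (l ++ [decide ((Nat.unpair p).2 = 1)]))) := by
    have hp : Primrec fun p : ℕ × List Bool => encode (p.2 ++ [decide ((Nat.unpair p.1).2 = 1)]) :=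
      Primrec.encode.comp (Primrec.list_append.comp .snd (Primrec.list_cons.comp
        (Primrec.eq.decide.comp (Primrec.snd.comp (Primrec.unpair.comp .fst)) (.const 1))
        (.const [])))
    exact Computable.option_map (Computable.decode.comp (Computable.snd.comp (Computable.unpair.comp
      (Computable.snd.comp (Computable.unpair.comp (Computable.fst.comp Computable.unpair))))))
      hp.to_comp.to₂
  obtain ⟨cg, hcg⟩ := OracleCode.exists_run_eq (Partrec.nat_iff.1 (Computable.ofOption hg))
  -- One step of a primitive recursion that reads the oracle into a string: on `(k, (i, l))`, query
  -- bit `i` and append it to `l`. Stages below `u σ` query only below `u σ`, so the cut-off oracle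
  -- suffices.
  let d : OracleCode := .comp cg (.pair cid (.comp .query (.comp .left .right)))
  have hd : ∀ v k i, i ≤ v → (OracleCode.prec cnil d).run (oracleBelow jumpZero v)
      (Nat.pair k i) = Part.some (encode (restr jumpZero i)) := by
    intro v k i hi
    induction i with
    | zero => simp [OracleCode.run_prec_zero, hcnil, restr]
    | succ i ih =>
      have hiv : i < v := hi
      rw [OracleCode.run_prec_succ, ih hiv.le]
      simp [d, OracleCode.run_comp, OracleCode.run_pair, OracleCode.run_query,
        OracleCode.run_left, OracleCode.run_right, hcg, hcid, oracleBelow, hiv, restr_succ]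
  refine ⟨.comp cF (.pair cid (.comp (.prec cnil d) (.pair cid cu))), u, hu, fun σ => ?_⟩
  have h₁ := hd (u σ) (encode σ) (u σ) le_rfl
  have h₂ := Part.eq_some_iff.2 (h σ)
  change OracleCode.run _ _ _ = _
  simp [OracleCode.run_comp, OracleCode.run_pair, hcF, hcid, hcu, h₁, h₂]

/-! ### Splitting families -/

/-- The functional `c` computes at least the string `η` from the finite oracle `τ`. -/
def Yields (c : OracleCode) (τ η : List Bool) : Prop :=
  ∀ m < η.length, ∃ b, η[m]? = some b ∧ b.toNat ∈ c.run (strOracle τ) m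

/-- Two strings disagree at some position. -/
def Incompatible (η η' : List Bool) : Prop :=
  ∃ p : ℕ × Bool, η[p.1]? = some p.2 ∧ η'[p.1]? = some !p.2

theorem rePred_yields (c : OracleCode) :
    REPred fun p : List Bool × List Bool => Yields c p.1 p.2 := by
  have h₁ : REPred fun q : ((List Bool × List Bool) × ℕ) × Bool => q.1.1.2[q.1.2]? = some q.2 :=
    REPred.computable_eq (Computable.list_getElem?.comp
      (Computable.snd.comp (Computable.fst.comp .fst)) (Computable.snd.comp .fst))
      (Computable.option_some.comp .snd)
  have h₂ : REPred fun q : ((List Bool × List Bool) × ℕ) × Bool =>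
      q.2.toNat ∈ c.run (strOracle q.1.1.1) q.1.2 :=
    REPred.mem_of_partrec ((OracleCode.partrec_run_strOracle c).comp
      ((Computable.fst.comp (Computable.fst.comp .fst)).pair (Computable.snd.comp .fst)))
      ((Primrec.dom_finite Bool.toNat).to_comp.comp .snd)
  exact (h₁.and h₂).exists.forall_lt (Computable.list_length.comp .snd)

theorem _root_.REPred.yields {α : Type*} [Primcodable α] (c : OracleCode) {f g : α → List Bool}
    (hf : Computable f) (hg : Computable g) : REPred fun a => Yields c (f a) (g a) :=
  REPred.comp (p := fun p : List Bool × List Bool => Yields c p.1 p.2) (rePred_yields c)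
    (hf.pair hg)

theorem rePred_incompatible :
    REPred fun p : List Bool × List Bool => Incompatible p.1 p.2 := by
  have h₁ : REPred fun q : (List Bool × List Bool) × ℕ × Bool => q.1.1[q.2.1]? = some q.2.2 :=
    REPred.computable_eq (Computable.list_getElem?.comp
      (Computable.fst.comp .fst) (Computable.fst.comp .snd))
      (Computable.option_some.comp (Computable.snd.comp .snd))
  have h₂ : REPred fun q : (List Bool × List Bool) × ℕ × Bool => q.1.2[q.2.1]? = some !q.2.2 :=
    REPred.computable_eq (Computable.list_getElem?.comp
      (Computable.snd.comp .fst) (Computable.fst.comp .snd))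
      (Computable.option_some.comp (Primrec.not.to_comp.comp (Computable.snd.comp .snd)))
  exact (h₁.and h₂).exists

theorem Yields.append {c : OracleCode} {τ η : List Bool} (h : Yields c τ η) (ρ : List Bool) :
    Yields c (τ ++ ρ) η := by
  intro m hm
  obtain ⟨b, hb, hb'⟩ := h m hm
  refine ⟨b, hb, OracleCode.run_mono (fun n v hv => ?_) c hb'⟩
  rw [mem_strOracle] at hv ⊢
  obtain ⟨b, hb, rfl⟩ := hv
  refine ⟨b, ?_, rfl⟩
  rw [List.getElem?_append_left (List.getElem?_eq_some_iff.1 hb).1, hb]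

theorem Yields.restr_mono {c : OracleCode} {X : Cantor} {η : List Bool} {k l : ℕ} (hkl : k ≤ l)
    (h : Yields c (restr X k) η) : Yields c (restr X l) η := by
  obtain ⟨j, rfl⟩ := Nat.exists_eq_add_of_le hkl
  obtain ⟨ρ, hρ⟩ := restr_add X k j
  exact hρ ▸ h.append ρ

/-- Computations are single-valued, and `Bool.toNat` is injective. -/
theorem Yields.agree {c : OracleCode} {τ η η' : List Bool} (h : Yields c τ η)
    (h' : Yields c τ η') {m : ℕ} (hm : m < η.length) (hm' : m < η'.length) : η[m] = η'[m] := by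
  obtain ⟨b, hb, hb'⟩ := h m hm
  obtain ⟨d, hd, hd'⟩ := h' m hm'
  rw [List.getElem?_eq_getElem hm, Option.some_inj] at hb
  rw [List.getElem?_eq_getElem hm', Option.some_inj] at hd
  rw [hb, hd]
  have := Part.mem_unique hb' hd'
  revert this
  cases b <;> cases d <;> simp

theorem Yields.not_incompatible {c : OracleCode} {τ η η' : List Bool} (h : Yields c τ η)
    (h' : Yields c τ η') : ¬ Incompatible η η' := by
  rintro ⟨⟨m, b⟩, hb, hb'⟩
  obtain ⟨hm, h₁⟩ := List.getElem?_eq_some_iff.1 hb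
  obtain ⟨hm', h₂⟩ := List.getElem?_eq_some_iff.1 hb'
  rw [← h.agree h' hm hm', h₁] at h₂
  simp at h₂

theorem Yields.eventually_restr {c : OracleCode} {X Z : Cantor}
    (h : c.eval (oracle X) = oracle Z) (L : ℕ) :
    ∀ᶠ k in Filter.atTop, Yields c (restr X k) (restr Z L) := by
  have : ∀ᶠ k in Filter.atTop, ∀ m ∈ Finset.range L,
      (Z m).toNat ∈ c.run (strOracle (restr X k)) m := by
    rw [Filter.eventually_all_finset]
    intro m _
    refine OracleCode.eventually_mem_run c ?_
    change _ ∈ c.eval (oracle X) m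
    rw [h]
    exact Part.mem_some _
  filter_upwards [this] with k hk m hm
  rw [length_restr] at hm
  exact ⟨Z m, getElem?_restr Z hm, hk m (Finset.mem_range.2 hm)⟩

theorem not_isPrefixOf_iff {η : List Bool} {Z : Cantor} :
    ¬ IsPrefixOf η Z ↔ ∃ i, ∃ h : i < η.length, η[i] = !Z i := by
  constructor
  · intro h
    by_contra! hc
    refine h (List.ext_getElem (by simp) fun i h₁ h₂ => ?_)
    rw [getElem_restr]
    exact (by simpa using hc i h₂ : η[i] = Z i).symm
  · rintro ⟨i, hi, h⟩ hp
    rw [hp.getElem hi] at h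
    simp at h

/-- If every string computed by `c` above a prefix of `G` is a prefix of `Z`, then `Z` is
computable. -/
theorem exists_yields_not_isPrefixOf {c : OracleCode} {G Z : Cantor}
    (h : c.eval (oracle G) = oracle Z) (hZ : ¬ Computable Z) (n : ℕ) :
    ∃ τ η, Yields c (restr G n ++ τ) η ∧ ¬ IsPrefixOf η Z := by
  by_contra! hc
  refine hZ ?_
  -- To compute `Z m`, search for any extension of the prefix with an image longer than `m`, and
  -- read bit `m` of that image. By `hc` the bit is correct, and the search ends because longer
  -- prefixes of `G` are such extensions.
  have hR : REPred fun q : ℕ × List Bool × List Bool =>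
      q.1 < q.2.2.length ∧ Yields c (restr G n ++ q.2.1) q.2.2 :=
    (REPred.computable_lt .fst (Computable.list_length.comp (Computable.snd.comp .snd))).and
      (REPred.yields c (Computable.list_append.comp (.const _) (Computable.fst.comp .snd))
        (Computable.snd.comp .snd))
  obtain ⟨s, hs, hs₁, hs₂⟩ := hR.exists_selection
  have ht : Partrec fun m => (s m).bind fun p => (p.2[m]? : Part Bool) :=
    hs.bind (Computable.ofOption (Computable.list_getElem?.comp
      (Computable.snd.comp .snd) .fst)).to₂
  refine ht.of_eq_tot fun m => ?_
  have hdom : (s m).Dom := by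
    obtain ⟨k, hk, hk'⟩ := ((Yields.eventually_restr h (m + 1)).and
      (Filter.eventually_ge_atTop n)).exists
    obtain ⟨j, rfl⟩ := Nat.exists_eq_add_of_le hk'
    obtain ⟨ρ, hρ⟩ := restr_add G n j
    exact hs₂ m (ρ, restr Z (m + 1)) ⟨by simp, hρ ▸ hk⟩
  obtain ⟨h₁, h₂⟩ := hs₁ m _ (Part.get_mem hdom)
  refine Part.mem_bind (Part.get_mem hdom) ?_
  rw [Part.mem_coe, Option.mem_def, List.getElem?_eq_getElem h₁, (hc _ _ h₂).getElem h₁]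

/-- If `G` computes a noncomputable set through `c`, then above every prefix of `G` there are
arbitrarily many strings with pairwise incompatible images under `c`. -/
theorem exists_splitting_family {c : OracleCode} {G Z : Cantor}
    (h : c.eval (oracle G) = oracle Z) (hZ : ¬ Computable Z) (k n : ℕ) :
    ∃ fam : List (List Bool × List Bool), fam.length = k ∧
      (∀ p ∈ fam, Yields c (restr G n ++ p.1) p.2 ∧ ¬ IsPrefixOf p.2 Z) ∧
      fam.Pairwise fun p q => Incompatible p.2 q.2 := by
  induction k generalizing n with
  | zero => exact ⟨[], by simp⟩
  | succ k ih =>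
    obtain ⟨τ₀, η₀, h₀, h₀'⟩ := exists_yields_not_isPrefixOf h hZ n
    -- Pass to a prefix of `G` that already computes `Z` on the length of `η₀`. All later images
    -- agree with `Z` there, so those which are not prefixes of `Z` must err beyond `η₀`. They are
    -- then long enough to disagree with `η₀` where `η₀` errs.
    obtain ⟨n', hn', hle⟩ := ((Yields.eventually_restr h η₀.length).and
      (Filter.eventually_ge_atTop n)).exists
    obtain ⟨j, rfl⟩ := Nat.exists_eq_add_of_le hle
    obtain ⟨ρ, hρ⟩ := restr_add G n j
    obtain ⟨fam, hlen, hfam, hpair⟩ := ih (n + j)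
    refine ⟨(τ₀, η₀) :: fam.map fun p => (ρ ++ p.1, p.2), by simp [hlen], ?_, ?_⟩
    · intro p hp
      rcases List.mem_cons.1 hp with rfl | hp
      · exact ⟨h₀, h₀'⟩
      · obtain ⟨q, hq, rfl⟩ := List.mem_map.1 hp
        have := hfam q hq
        rwa [hρ, List.append_assoc] at this
    · refine List.pairwise_cons.2 ⟨fun p hp => ?_, List.pairwise_map.2 hpair⟩
      obtain ⟨q, hq, rfl⟩ := List.mem_map.1 hp
      obtain ⟨hq₁, hq₂⟩ := hfam q hq
      have hZq : ∀ m (hm : m < q.2.length), m < η₀.length → q.2[m] = Z m := fun m hm hm' => by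
        rw [hq₁.agree (hn'.append q.1) hm (by simpa using hm'), getElem_restr]
      obtain ⟨i, hi, hi'⟩ := not_isPrefixOf_iff.1 h₀'
      obtain ⟨l, hl, hl'⟩ := not_isPrefixOf_iff.1 hq₂
      have hiq : i < q.2.length := by
        by_contra! hcon
        rw [hZq l hl (by omega)] at hl'
        simp at hl'
      refine ⟨(i, !Z i), ?_, ?_⟩
      · rw [List.getElem?_eq_getElem hi, hi']
      · rw [List.getElem?_eq_getElem hiq, hZq i hiq hi, Bool.not_not]

/-! ### Measure -/

instance : IsProbabilityMeasure lebesgue := by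
  unfold lebesgue
  infer_instance

theorem setOf_isPrefixOf_eq_pi (ρ : List Bool) :
    {X : Cantor | IsPrefixOf ρ X} =
      Set.pi (Finset.range ρ.length) fun i => {ρ.getD i false} := by
  ext X
  simp only [Set.mem_ofPred_eq, Set.mem_pi, Finset.coe_range, Set.mem_Iio, Set.mem_singleton_iff]
  constructor
  · intro h i hi
    rw [List.getD_eq_getElem _ _ hi, h.getElem hi]
  · intro h
    refine List.ext_getElem (by simp) fun i h₁ h₂ => ?_
    rw [getElem_restr, h i h₂, List.getD_eq_getElem _ _ h₂]

theorem measurableSet_isPrefixOf (ρ : List Bool) : MeasurableSet {X : Cantor | IsPrefixOf ρ X} := by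
  rw [setOf_isPrefixOf_eq_pi]
  exact MeasurableSet.pi (Finset.countable_toSet _) fun _ _ => measurableSet_singleton _

theorem lebesgue_isPrefixOf (ρ : List Bool) :
    lebesgue {X | IsPrefixOf ρ X} = (2 : ℝ≥0∞)⁻¹ ^ ρ.length := by
  rw [setOf_isPrefixOf_eq_pi, lebesgue, Measure.infinitePi_pi _ fun _ _ => measurableSet_singleton _]
  simp

theorem lebesgue_restr_mem {S : Finset (List Bool)} {l : ℕ} (hS : ∀ ρ ∈ S, ρ.length = l) :
    lebesgue {X | restr X l ∈ S} = S.card * (2 : ℝ≥0∞)⁻¹ ^ l := by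
  have : {X | restr X l ∈ S} = ⋃ ρ ∈ S, {X | IsPrefixOf ρ X} := by
    ext X
    simp only [Set.mem_ofPred_eq, Set.mem_iUnion, exists_prop]
    constructor
    · exact fun h => ⟨_, h, isPrefixOf_restr X l⟩
    · rintro ⟨ρ, h, h'⟩
      rw [IsPrefixOf, hS ρ h] at h'
      rwa [h']
  rw [this, measure_biUnion_finset _ fun ρ _ => measurableSet_isPrefixOf ρ]
  · rw [Finset.sum_congr rfl fun ρ hρ => by rw [lebesgue_isPrefixOf, hS ρ hρ]]
    simp
  · intro ρ hρ ρ' hρ' hne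
    refine Set.disjoint_left.2 fun X h h' => hne ?_
    simp only [Set.mem_ofPred_eq, IsPrefixOf] at h h'
    rw [← h, ← h', hS ρ hρ, hS ρ' hρ']

/-- The set of oracles from which `c` computes at least the string `η`. -/
def yieldSet (c : OracleCode) (η : List Bool) : Set Cantor :=
  {X | ∃ l, Yields c (restr X l) η}

theorem yieldSet_eq_iUnion (c : OracleCode) (η : List Bool) :
    yieldSet c η = ⋃ ρ ∈ {ρ | Yields c ρ η}, {X | IsPrefixOf ρ X} := by
  ext X
  simp only [yieldSet, Set.mem_ofPred_eq, Set.mem_iUnion, exists_prop]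
  constructor
  · exact fun ⟨l, hl⟩ => ⟨_, hl, isPrefixOf_restr X l⟩
  · rintro ⟨ρ, h, h'⟩
    exact ⟨ρ.length, h'.symm ▸ h⟩

theorem measurableSet_yieldSet (c : OracleCode) (η : List Bool) :
    MeasurableSet (yieldSet c η) := by
  rw [yieldSet_eq_iUnion]
  exact MeasurableSet.biUnion (Set.to_countable _) fun ρ _ => measurableSet_isPrefixOf ρ

/-- A common element would have a single prefix long enough to compute both strings. -/
theorem disjoint_yieldSet (c : OracleCode) {η η' : List Bool} (h : Incompatible η η') :
    Disjoint (yieldSet c η) (yieldSet c η') := by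
  refine Set.disjoint_left.2 ?_
  rintro X ⟨l, hl⟩ ⟨l', hl'⟩
  exact (hl.restr_mono (le_max_left l l')).not_incompatible
    (hl'.restr_mono (le_max_right l l')) h

/-- A finite certificate that the measure of `yieldSet c η` exceeds `1 / N`. -/
def IsLarge (c : OracleCode) (η : List Bool) (N : ℕ) : Prop :=
  ∃ q : List (List Bool) × ℕ, q.1.Pairwise (fun ρ ρ' => ρ ≠ ρ') ∧
    (∀ ρ ∈ q.1, ρ.length = q.2 ∧ Yields c ρ η) ∧ 2 ^ q.2 < q.1.length * N

theorem ennreal_lt_iff {a l N : ℕ} (hN : 0 < N) :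
    (N : ℝ≥0∞)⁻¹ < a * (2 : ℝ≥0∞)⁻¹ ^ l ↔ 2 ^ l < a * N := by
  rw [← ENNReal.inv_pow, ← div_eq_mul_inv,
    ENNReal.lt_div_iff_mul_lt (.inl (by simp)) (.inl (by simp)), mul_comm, ← div_eq_mul_inv,
    ENNReal.div_lt_iff (.inl (by simp [hN.ne'])) (.inl (by simp))]
  exact_mod_cast Iff.rfl

theorem IsLarge.lt_lebesgue {c : OracleCode} {η : List Bool} {N : ℕ} (h : IsLarge c η N) :
    (N : ℝ≥0∞)⁻¹ < lebesgue (yieldSet c η) := by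
  obtain ⟨⟨S, l⟩, hS, hS', hlt⟩ := h
  have hN : 0 < N := by
    rcases Nat.eq_zero_or_pos N with rfl | hN
    · simp at hlt
    · exact hN
  refine lt_of_lt_of_le ((ennreal_lt_iff hN).2 hlt) ?_
  rw [← List.toFinset_card_of_nodup hS, ← lebesgue_restr_mem fun ρ hρ =>
    (hS' ρ (List.mem_toFinset.1 hρ)).1]
  exact measure_mono fun X hX => ⟨l, (hS' _ (List.mem_toFinset.1 hX)).2⟩

/-- The preimage is the increasing union of its approximations by prefixes of length `l`. If one
approximation had measure above `1 / N`, its strings of length `l` would form a certificate of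
largeness. -/
theorem lebesgue_yieldSet_le {c : OracleCode} {η : List Bool} {N : ℕ} (hN : 0 < N)
    (h : ¬ IsLarge c η N) : lebesgue (yieldSet c η) ≤ (N : ℝ≥0∞)⁻¹ := by
  classical
  have hU : yieldSet c η = ⋃ l, {X | Yields c (restr X l) η} := by
    ext X
    simp [yieldSet]
  have hmono : Monotone fun l => {X : Cantor | Yields c (restr X l) η} :=
    fun k l hkl X hX => Yields.restr_mono hkl hX
  rw [hU, hmono.measure_iUnion]
  refine iSup_le fun l => ?_
  let S : Finset (List Bool) := (List.finite_length_eq Bool l).toFinset.filter fun ρ => Yields c ρ η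
  have hS : ∀ ρ ∈ S, ρ.length = l ∧ Yields c ρ η := fun ρ hρ => by simpa [S] using hρ
  have hset : {X | Yields c (restr X l) η} = {X | restr X l ∈ S} := by
    ext X
    simp [S]
  rw [hset, lebesgue_restr_mem fun ρ hρ => (hS ρ hρ).1, ← not_lt, ennreal_lt_iff hN]
  refine fun hlt => h ⟨(S.toList, l), S.nodup_toList, fun ρ hρ => hS ρ (by simpa using hρ), ?_⟩
  simpa using hlt

/-- Among more than `N` strings that are pairwise incompatible, one has small measure. -/
theorem exists_not_isLarge (c : OracleCode) {N : ℕ} (hN : 0 < N)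
    {fam : List (List Bool × List Bool)} (hlen : fam.length = N + 1)
    (hfam : fam.Pairwise fun p q => Incompatible p.2 q.2) :
    ∃ p ∈ fam, ¬ IsLarge c p.2 N := by
  by_contra! hc
  have hdisj : Pairwise (Function.onFun Disjoint fun i : Fin fam.length =>
      yieldSet c fam[i].2) := by
    rw [List.pairwise_iff_getElem] at hfam
    intro i j hij
    rcases lt_or_gt_of_ne hij with h | h
    · exact disjoint_yieldSet c (hfam i j i.2 j.2 h)
    · exact (disjoint_yieldSet c (hfam j i j.2 i.2 h)).symm
  have h₁ : lebesgue (⋃ i : Fin fam.length, yieldSet c fam[i].2) ≤ 1 := prob_le_one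
  rw [measure_iUnion hdisj fun i => measurableSet_yieldSet c _, tsum_fintype] at h₁
  have h₂ : ∑ _i : Fin fam.length, (N : ℝ≥0∞)⁻¹ ≤
      ∑ i : Fin fam.length, lebesgue (yieldSet c fam[i].2) :=
    Finset.sum_le_sum fun i _ => (hc _ (List.getElem_mem i.2)).lt_lebesgue.le
  have h₃ := h₂.trans h₁
  rw [Finset.sum_const, Finset.card_univ, Fintype.card_fin, hlen, nsmul_eq_mul, ← div_eq_mul_inv,
    ENNReal.div_le_iff (by simp [hN.ne']) (by simp), one_mul] at h₃
  have : N + 1 ≤ N := by exact_mod_cast h₃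
  omega

theorem computable₂_pow : Computable₂ fun a b : ℕ => a ^ b :=
  (Primrec₂.unpaired'.1 Nat.Primrec.pow).to_comp

theorem rePred_isLarge (c : OracleCode) :
    REPred fun p : List Bool × ℕ => IsLarge c p.1 p.2 := by
  have hlen : REPred fun q : ((List Bool × ℕ) × List (List Bool) × ℕ) × List Bool =>
      q.2.length = q.1.2.2 :=
    REPred.computable_eq (Computable.list_length.comp .snd)
      (Computable.snd.comp (Computable.snd.comp .fst))
  have hy : REPred fun q : ((List Bool × ℕ) × List (List Bool) × ℕ) × List Bool =>
      Yields c q.2 q.1.1.1 :=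
    REPred.yields c .snd (Computable.fst.comp (Computable.fst.comp .fst))
  have hne : REPred fun p : List Bool × List Bool => p.1 ≠ p.2 :=
    (Primrec.eq (α := List Bool)).not.computablePred.to_re
  have hlt : REPred fun q : (List Bool × ℕ) × List (List Bool) × ℕ =>
      2 ^ q.2.2 < q.2.1.length * q.1.2 :=
    REPred.computable_lt (computable₂_pow.comp (.const 2) (Computable.snd.comp .snd))
      (Primrec.nat_mul.to_comp.comp (Computable.list_length.comp (Computable.fst.comp .snd))
        (Computable.snd.comp .fst))
  have hnodup : REPred fun q : (List Bool × ℕ) × List (List Bool) × ℕ =>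
      q.2.1.Pairwise fun ρ ρ' => ρ ≠ ρ' :=
    hne.pairwise_list.comp (Computable.fst.comp .snd)
  have hall : REPred fun q : (List Bool × ℕ) × List (List Bool) × ℕ =>
      ∀ ρ ∈ q.2.1, ρ.length = q.2.2 ∧ Yields c ρ q.1.1 :=
    (hlen.and hy).forall_mem_list (Computable.fst.comp .snd)
  exact (hnodup.and (hall.and hlt)).exists

/-! ### Noncomputability -/

theorem computable_restr {X : Cantor} (hX : Computable X) : Computable fun n => restr X n := by
  have : Computable₂ fun (_ : ℕ) (q : ℕ × List Bool) => q.2 ++ [X q.1] :=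
    Computable.list_concat.comp (Computable.snd.comp .snd) (hX.comp (Computable.fst.comp .snd))
  refine (Computable.nat_rec Computable.id (Computable.const ([] : List Bool)) this).of_eq
    fun n => ?_
  simp only [id]
  induction n with
  | zero => rfl
  | succ n ih => rw [restr_succ, ← ih]

/-- The cylinders of the prefixes of a computable `X` form a test with no mind changes that captures
`X` at every level. -/
theorem IsDemuthRandom.not_computable {X : Cantor} (hX : IsDemuthRandom X) : ¬ Computable X := by
  intro hc
  have hR : REPred fun p : ℕ × List Bool => p.2 = restr X p.1 :=
    REPred.computable_eq .snd ((computable_restr hc).comp .fst)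
  obtain ⟨s, hs, h⟩ := hR.exists_index
  have hset : ∀ n, effOpen (s n) = {Y | IsPrefixOf (restr X n) Y} := fun n => by
    ext Y
    simp [effOpen, h]
  have hfin := hX s ⟨⟨fun n _ => s n, fun _ => 0, hs.to_comp.comp .fst, .const 0, fun n => by simp⟩,
    fun n => by rw [hset, lebesgue_isPrefixOf, length_restr]⟩
  refine Set.infinite_univ (hfin.subset fun n _ => ?_)
  change X ∈ effOpen (s n)
  rw [hset]
  exact isPrefixOf_restr X n

/-- If `G` is computable, then so is the extension function that appends the opposite of the next
bit of `G`, and `G` never meets it. -/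
theorem IsPbGeneric.not_computable {G : Cantor} (hG : IsPbGeneric G) : ¬ Computable G := by
  intro hc
  have hf : Computable fun p : List Bool × List Bool => p.1 ++ [!G p.1.length] :=
    Computable.list_concat.comp .fst
      (Primrec.not.to_comp.comp (hc.comp (Computable.list_length.comp .fst)))
  have hinf := hG (fun σ => σ ++ [!G σ.length])
    (PbComputable.of_restr hf.partrec (Primrec.const 0) fun σ => Part.mem_some _)
    fun σ => List.prefix_append _ _
  obtain ⟨n, hn⟩ := hinf.nonempty
  change restr G _ = _ at hn
  simp [restr_succ] at hn

/-! ### Approximations of the halting problem -/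

/-- The part of the halting problem that is enumerated after `t` steps. -/
def jumpApprox (t : ℕ) : Cantor :=
  fun e => (Nat.Partrec.Code.evaln t (Denumerable.ofNat Nat.Partrec.Code e) e).isSome

theorem jumpApprox_mono {t t' e : ℕ} (h : t ≤ t') (he : jumpApprox t e = true) :
    jumpApprox t' e = true := by
  obtain ⟨v, hv⟩ := Option.isSome_iff_exists.1 he
  exact Option.isSome_iff_exists.2 ⟨v, Nat.Partrec.Code.evaln_mono h hv⟩

theorem jumpZero_eq_true_iff {e : ℕ} : jumpZero e = true ↔ ∃ t, jumpApprox t e = true := by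
  simp only [jumpZero, jumpApprox, decide_eq_true_eq, Part.dom_iff_mem, Option.isSome_iff_exists]
  rw [exists_comm]
  exact exists_congr fun v => Nat.Partrec.Code.evaln_complete

theorem eventually_jumpApprox_eq (e : ℕ) : ∀ᶠ t in Filter.atTop, jumpApprox t e = jumpZero e := by
  by_cases h : jumpZero e = true
  · obtain ⟨t, ht⟩ := jumpZero_eq_true_iff.1 h
    filter_upwards [Filter.eventually_ge_atTop t] with t' ht'
    rw [h, jumpApprox_mono ht' ht]
  · refine .of_forall fun t => ?_
    rw [Bool.not_eq_true] at h
    rw [h, ← Bool.not_eq_true]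
    intro ht
    rw [jumpZero_eq_true_iff.2 ⟨t, ht⟩] at h
    cases h

theorem restr_congr {X Y : Cantor} {n : ℕ} (h : ∀ i < n, X i = Y i) : restr X n = restr Y n :=
  List.map_congr_left fun i hi => h i (List.mem_range.1 hi)

theorem primrec_restr_jumpApprox : Primrec fun p : ℕ × ℕ => restr (jumpApprox p.1) p.2 := by
  have : Primrec₂ fun (p : ℕ × ℕ) (e : ℕ) => jumpApprox p.1 e :=
    Primrec.option_isSome.comp (Nat.Partrec.Code.primrec_evaln.comp
      (((Primrec.fst.comp .fst).pair ((Primrec.ofNat Nat.Partrec.Code).comp .snd)).pair .snd))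
  exact Primrec.list_map (Primrec.list_range.comp .snd) this

/-- A function computable from an initial segment, of computable length, of the halting problem is
`ω`-c.a. -/
theorem IsOmegaCA.of_restr {s : ℕ × List Bool → ℕ} (hs : Computable s) {u : ℕ → ℕ}
    (hu : Computable u) : IsOmegaCA fun x => s (x, restr jumpZero (u x)) := by
  refine ⟨fun x t => s (x, restr (jumpApprox t) (u x)), u, ?_, hu, fun x => ⟨?_, ?_⟩⟩
  · exact hs.comp (Computable.fst.pair
      (primrec_restr_jumpApprox.to_comp.comp (Computable.snd.pair (hu.comp .fst))))
  -- Each mind change is caused by some `e < u x` entering the enumeration of the halting problem.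
  -- An element enters only once, so the changes inject into the numbers below `u x`.
  · have hch : ∀ t ∈ {t | s (x, restr (jumpApprox t) (u x)) ≠
        s (x, restr (jumpApprox (t + 1)) (u x))},
        ∃ e < u x, jumpApprox t e = false ∧ jumpApprox (t + 1) e = true := by
      intro t ht
      by_contra! hc
      refine ht (congrArg (fun l => s (x, l)) (restr_congr fun e he => ?_))
      cases h : jumpApprox t e with
      | false => simpa using (hc e he h).symm
      | true => exact (jumpApprox_mono t.le_succ h).symm
    choose! e he he₁ he₂ using hch
    have hinj : Set.InjOn e {t | s (x, restr (jumpApprox t) (u x)) ≠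
        s (x, restr (jumpApprox (t + 1)) (u x))} := by
      intro t ht t' ht' heq
      by_contra hne
      rcases lt_or_gt_of_ne hne with h | h
      · have := jumpApprox_mono h (he₂ t ht)
        rw [heq, he₁ t' ht'] at this
        cases this
      · have := jumpApprox_mono h (he₂ t' ht')
        rw [← heq, he₁ t ht] at this
        cases this
    refine (Set.encard_le_encard_of_injOn (t := (Finset.range (u x) : Set ℕ))
      (fun t ht => ?_) hinj).trans ?_
    · simpa using he t ht
    · rw [Set.encard_coe_eq_coe_finsetCard, Finset.card_range]
  · have : ∀ᶠ t in Filter.atTop, ∀ e ∈ Finset.range (u x), jumpApprox t e = jumpZero e := by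
      rw [Filter.eventually_all_finset]
      exact fun e _ => eventually_jumpApprox_eq e
    filter_upwards [this] with t ht
    rw [restr_congr fun e he => ht e (Finset.mem_range.2 he)]

/-- The running maximum of `f (a, i) + 1` is primitive recursive; it serves to bound the use of
finitely many oracle questions. -/
theorem exists_primrec_bound {α : Type*} [Primcodable α] {f : α × ℕ → ℕ} (hf : Primrec f)
    {n : α → ℕ} (hn : Primrec n) : ∃ u : α → ℕ, Primrec u ∧ ∀ a, ∀ i < n a, f (a, i) < u a := by
  have : Primrec₂ fun (a : α) (q : ℕ × ℕ) => max q.2 (f (a, q.1) + 1) :=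
    Primrec.nat_max.comp (Primrec.snd.comp .snd)
      (Primrec.succ.comp (hf.comp (Primrec.fst.pair (Primrec.fst.comp .snd))))
  refine ⟨_, Primrec.nat_rec' hn (Primrec.const 0) this, fun a => ?_⟩
  induction n a with
  | zero => simp
  | succ k ih =>
    intro i hi
    rcases Nat.lt_succ_iff_lt_or_eq.1 hi with h | rfl
    · exact lt_of_lt_of_le (ih i h) (le_max_left _ _)
    · exact (Nat.lt_succ_self _).trans_le (le_max_right _ _)

/-! ### Choosing an extension with small preimage -/

/-- A list of strings extending `σ` with pairwise incompatible images under `c`, long enough for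
one of the images to have small measure. -/
def IsSplittingFamily (c : OracleCode) (σ : List Bool) (fam : List (List Bool × List Bool)) :
    Prop :=
  fam.length = 2 ^ encode σ + 1 ∧ (∀ p ∈ fam, Yields c (σ ++ p.1) p.2) ∧
    fam.Pairwise fun p q => Incompatible p.2 q.2

theorem rePred_isSplittingFamily (c : OracleCode) :
    REPred fun q : List Bool × List (List Bool × List Bool) => IsSplittingFamily c q.1 q.2 := by
  have h₁ : REPred fun q : List Bool × List (List Bool × List Bool) =>
      q.2.length = 2 ^ encode q.1 + 1 :=
    REPred.computable_eq (Computable.list_length.comp .snd)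
      (Computable.succ.comp (computable₂_pow.comp (.const 2) (Computable.encode.comp .fst)))
  have h₂ : REPred fun q : (List Bool × List (List Bool × List Bool)) × List Bool × List Bool =>
      Yields c (q.1.1 ++ q.2.1) q.2.2 :=
    REPred.yields c (Computable.list_append.comp (Computable.fst.comp .fst)
      (Computable.fst.comp .snd)) (Computable.snd.comp .snd)
  have h₃ : REPred fun q : List Bool × List (List Bool × List Bool) =>
      ∀ p ∈ q.2, Yields c (q.1 ++ p.1) p.2 :=
    h₂.forall_mem_list Computable.snd
  have h₄ : REPred fun q : (List Bool × List Bool) × List Bool × List Bool =>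
      Incompatible q.1.2 q.2.2 :=
    REPred.comp (p := fun p : List Bool × List Bool => Incompatible p.1 p.2) rePred_incompatible
      ((Computable.snd.comp .fst).pair (Computable.snd.comp .snd))
  have h₅ : REPred fun q : List Bool × List (List Bool × List Bool) =>
      q.2.Pairwise fun p q => Incompatible p.2 q.2 :=
    h₄.pairwise_list.comp Computable.snd
  exact h₁.and (h₃.and h₅)

/-- From a bounded initial segment of the halting problem one can compute, for each `σ` that has a
splitting family, an extension of `σ` whose image has a preimage of small measure. -/
theorem exists_small_extension (Γ Ψ : OracleCode) :
    ∃ (F : List Bool × List Bool →. List Bool × List Bool) (q u : List Bool → ℕ),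
      Partrec F ∧ Primrec q ∧ Primrec u ∧ (∀ σ, q σ < u σ) ∧
      (∀ σ, (∃ fam, IsSplittingFamily Γ σ fam) → jumpZero (q σ) = true) ∧
      (∀ σ, jumpZero (q σ) = true → (F (σ, restr jumpZero (u σ))).Dom) ∧
      ∀ σ, ∀ p ∈ F (σ, restr jumpZero (u σ)),
        Yields Γ (σ ++ p.1) p.2 ∧ ¬ IsLarge Ψ p.2 (2 ^ encode σ) := by
  obtain ⟨h, hh, h₁, h₂⟩ := (rePred_isSplittingFamily Γ).exists_selection
  obtain ⟨q, hq, hqs⟩ := (Partrec.dom_re hh).exists_reduction_jumpZero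
  have hmem : REPred fun a : (List Bool × ℕ) × List Bool × List Bool =>
      a.2 ∈ (h a.1.1).bind fun fam => (fam[a.1.2]? : Part (List Bool × List Bool)) :=
    REPred.mem_of_partrec ((hh.comp (Computable.fst.comp .fst)).bind
      (Computable.ofOption (Computable.list_getElem?.comp .snd
        (Computable.snd.comp (Computable.fst.comp .fst)))).to₂) .snd
  have hlarge : REPred fun a : (List Bool × ℕ) × List Bool × List Bool =>
      IsLarge Ψ a.2.2 (2 ^ encode a.1.1) :=
    REPred.comp (p := fun p : List Bool × ℕ => IsLarge Ψ p.1 p.2) (rePred_isLarge Ψ)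
      ((Computable.snd.comp .snd).pair (computable₂_pow.comp (.const 2)
        (Computable.encode.comp (Computable.fst.comp .fst))))
  -- `r (σ, i)` asks `∅'` whether the family found for `σ` has an `i`-th member with large preimage.
  obtain ⟨r, hr, hrs⟩ := (hmem.and hlarge).exists.exists_reduction_jumpZero
  have hpow : Primrec fun σ : List Bool => 2 ^ encode σ + 1 :=
    Primrec.succ.comp ((Primrec₂.unpaired'.1 Nat.Primrec.pow).comp (.const 2) .encode)
  obtain ⟨u, hu, hur⟩ := exists_primrec_bound hr hpow
  -- The use covers the existence question `q σ` and all `2 ^ encode σ + 1` largeness questions.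
  have hu' : Primrec fun σ => max (u σ) (q σ + 1) :=
    Primrec.nat_max.comp hu (Primrec.succ.comp hq)
  have hi : Partrec fun a : (List Bool × List Bool) × List (List Bool × List Bool) =>
      Nat.rfind fun i => Part.some !(a.1.2.getD (r (a.1.1, i)) false) := by
    have : Computable fun b : ((List Bool × List Bool) × List (List Bool × List Bool)) × ℕ =>
        !(b.1.1.2.getD (r (b.1.1.1, b.2)) false) :=
      Primrec.not.to_comp.comp ((Primrec.list_getD false).to_comp.comp
        (Computable.snd.comp (Computable.fst.comp .fst))
        (hr.to_comp.comp ((Computable.fst.comp (Computable.fst.comp .fst)).pair .snd)))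
    exact Partrec.rfind this.partrec.to₂
  have hF : Partrec fun a : List Bool × List Bool => (h a.1).bind fun fam =>
      (Nat.rfind fun i => Part.some !(a.2.getD (r (a.1, i)) false)).bind fun i =>
        (fam[i]? : Part (List Bool × List Bool)) :=
    (hh.comp .fst).bind (hi.bind (Computable.ofOption (Computable.list_getElem?.comp
      (Computable.snd.comp .fst) .snd)).to₂).to₂
  have hans : ∀ σ, ∀ fam ∈ h σ, ∀ i (hi : i < fam.length),
      (restr jumpZero (max (u σ) (q σ + 1))).getD (r (σ, i)) false = true ↔
        IsLarge Ψ fam[i].2 (2 ^ encode σ) := by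
    intro σ fam hfam i hi
    have hlt : r (σ, i) < max (u σ) (q σ + 1) :=
      lt_of_lt_of_le (hur σ i (by rw [← (h₁ σ fam hfam).1]; exact hi)) (le_max_left _ _)
    rw [List.getD_eq_getElem?_getD, getElem?_restr _ hlt, Option.getD_some, hrs]
    constructor
    · rintro ⟨p, hp, hp'⟩
      obtain ⟨fam', hfam', hp⟩ := Part.mem_bind_iff.1 hp
      obtain rfl := Part.mem_unique hfam hfam'
      rw [Part.mem_coe, Option.mem_def, List.getElem?_eq_getElem hi, Option.some_inj] at hp
      subst hp
      exact hp'
    · refine fun hl => ⟨fam[i], Part.mem_bind hfam ?_, hl⟩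
      rw [Part.mem_coe, Option.mem_def, List.getElem?_eq_getElem hi]
  refine ⟨_, q, _, hF, hq, hu', fun σ => lt_of_lt_of_le (Nat.lt_succ_self _) (le_max_right _ _),
    fun σ ⟨fam, hfam⟩ => (hqs σ).2 (h₂ σ fam hfam), fun σ hσ => ?_, fun σ p hp => ?_⟩
  · obtain ⟨fam, hfam⟩ := Part.dom_iff_mem.1 ((hqs σ).1 hσ)
    obtain ⟨hlen, -, hinc⟩ := h₁ σ fam hfam
    obtain ⟨p, hp, hp'⟩ := exists_not_isLarge Ψ (Nat.two_pow_pos _) hlen hinc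
    obtain ⟨i, hi, rfl⟩ := List.getElem_of_mem hp
    rw [← hans σ fam hfam i hi, Bool.not_eq_true] at hp'
    -- The search stops no later than at the small member `i`, so its result is an index inside the
    -- family.
    obtain ⟨j, hj, hji⟩ := Nat.rfind_min' (p := fun i =>
      !((restr jumpZero (max (u σ) (q σ + 1))).getD (r (σ, i)) false)) (m := i) (by rw [hp']; rfl)
    have hj' : j < fam.length := lt_of_le_of_lt hji hi
    refine Part.dom_iff_mem.2 ⟨fam[j], Part.mem_bind hfam (Part.mem_bind hj ?_)⟩
    rw [Part.mem_coe, Option.mem_def, List.getElem?_eq_getElem]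
  · obtain ⟨fam, hfam, hp⟩ := Part.mem_bind_iff.1 hp
    obtain ⟨i, hi, hp⟩ := Part.mem_bind_iff.1 hp
    rw [Part.mem_coe, Option.mem_def] at hp
    obtain ⟨hlt, rfl⟩ := List.getElem?_eq_some_iff.1 hp
    refine ⟨(h₁ σ fam hfam).2.1 _ (List.getElem_mem hlt), ?_⟩
    have := Nat.rfind_spec hi
    rw [Part.mem_some_iff] at this
    rw [← hans σ fam hfam i hlt, Bool.not_eq_true]
    simpa using this

/-- The extensions chosen by `exists_small_extension` form a function that is computable from the
halting problem with primitive recursively bounded use. -/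
theorem exists_pbComputable_extension {F : List Bool × List Bool →. List Bool × List Bool}
    {q u : List Bool → ℕ} (hF : Partrec F) (hq : Primrec q) (hu : Primrec u)
    (hqu : ∀ σ, q σ < u σ)
    (hdom : ∀ σ, jumpZero (q σ) = true → (F (σ, restr jumpZero (u σ))).Dom) :
    ∃ f : List Bool → List Bool, PbComputable f ∧ (∀ σ, σ <+: f σ) ∧
      ∀ σ, jumpZero (q σ) = true → ∃ p ∈ F (σ, restr jumpZero (u σ)), f σ = σ ++ p.1 := by
  -- A string for which no family is found is left unextended; this keeps the extension function
  -- total.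
  let E : List Bool × List Bool →. List Bool := fun a =>
    cond (a.2.getD (q a.1) false) ((F a).map fun p => a.1 ++ p.1) (Part.some a.1)
  have hE : Partrec E :=
    Partrec.cond ((Primrec.list_getD false).to_comp.comp .snd (hq.to_comp.comp .fst))
      (hF.map (Computable.list_append.comp (Computable.fst.comp .fst)
        (Computable.fst.comp .snd)).to₂) Computable.fst.partrec
  have hans : ∀ σ, (restr jumpZero (u σ)).getD (q σ) false = jumpZero (q σ) := fun σ => by
    rw [List.getD_eq_getElem?_getD, getElem?_restr _ (hqu σ), Option.getD_some]
  have key : ∀ σ, ∃ τ ∈ E (σ, restr jumpZero (u σ)), σ <+: τ ∧ (jumpZero (q σ) = true →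
      ∃ p ∈ F (σ, restr jumpZero (u σ)), τ = σ ++ p.1) := by
    intro σ
    simp only [E, hans]
    cases h : jumpZero (q σ) with
    | false => exact ⟨σ, Part.mem_some _, List.prefix_rfl, fun h => by cases h⟩
    | true =>
      obtain ⟨p, hp⟩ := Part.dom_iff_mem.1 (hdom σ h)
      exact ⟨σ ++ p.1, Part.mem_map _ hp, List.prefix_append _ _, fun _ => ⟨p, hp, rfl⟩⟩
  choose f hf₁ hf₂ hf₃ using key
  exact ⟨f, PbComputable.of_restr hE hu hf₁, hf₂, hf₃⟩

/-- The preimages of small measure chosen by `exists_small_extension` form a Demuth test. -/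
theorem exists_demuthTest {Ψ : OracleCode}
    {F : List Bool × List Bool →. List Bool × List Bool} {u : List Bool → ℕ}
    (hF : Partrec F) (hu : Primrec u)
    (hsmall : ∀ σ, ∀ p ∈ F (σ, restr jumpZero (u σ)), ¬ IsLarge Ψ p.2 (2 ^ encode σ)) :
    ∃ g : ℕ → ℕ, IsDemuthTest g ∧
      ∀ σ, ∀ p ∈ F (σ, restr jumpZero (u σ)), yieldSet Ψ p.2 ⊆ effOpen (g (encode σ)) := by
  -- The initial segment of `∅'` is a parameter here, so the index `s` is total even on wrong
  -- approximations of it. Only the limit index has to satisfy the measure bound.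
  have hR : REPred fun a : ((ℕ × List Bool) × List Bool) × List Bool × List Bool × List Bool =>
      encode a.2.1 = a.1.1.1 ∧ a.2.2 ∈ F (a.2.1, a.1.1.2) ∧ Yields Ψ a.1.2 a.2.2.2 := by
    refine REPred.and ?_ (REPred.and ?_ ?_)
    · exact REPred.computable_eq (Computable.encode.comp (Computable.fst.comp .snd))
        (Computable.fst.comp (Computable.fst.comp .fst))
    · exact REPred.mem_of_partrec (hF.comp ((Computable.fst.comp .snd).pair
        (Computable.snd.comp (Computable.fst.comp .fst)))) (Computable.snd.comp .snd)
    · exact REPred.yields Ψ (Computable.snd.comp .fst)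
        (Computable.snd.comp (Computable.snd.comp .snd))
  obtain ⟨s, hs, hsR⟩ := hR.exists.exists_index
  have hv : Computable fun x : ℕ => ((decode (α := List Bool) x).map u).getD 0 :=
    Computable.option_getD (Computable.option_map .decode (hu.to_comp.comp .snd).to₂) (.const 0)
  let g : ℕ → ℕ := fun x => s (x, restr jumpZero (((decode (α := List Bool) x).map u).getD 0))
  have hg : ∀ σ X, X ∈ effOpen (g (encode σ)) ↔
      ∃ p ∈ F (σ, restr jumpZero (u σ)), X ∈ yieldSet Ψ p.2 := by
    intro σ X
    simp only [effOpen, Set.mem_ofPred_eq, g, encodek, Option.map_some, Option.getD_some, hsR,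
      encode_inj, yieldSet]
    constructor
    · rintro ⟨ρ, ⟨⟨σ', p⟩, h₁, h₂, h₃⟩, hρ⟩
      obtain rfl : σ' = σ := h₁
      exact ⟨p, h₂, ρ.length, hρ.symm ▸ h₃⟩
    · rintro ⟨p, hp, l, hl⟩
      exact ⟨restr X l, ⟨(σ, p), rfl, hp, hl⟩, isPrefixOf_restr X l⟩
  refine ⟨g, ⟨IsOmegaCA.of_restr hs.to_comp hv, fun x => ?_⟩, fun σ p hp X hX =>
    (hg σ X).2 ⟨p, hp, hX⟩⟩
  -- A level is empty when `x` codes no string or `F` diverges. Otherwise `F` has a unique value,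
  -- and the level lies in the preimage of its image.
  rcases (effOpen (g x)).eq_empty_or_nonempty with h | ⟨X, hX⟩
  · rw [h, measure_empty]
    exact zero_le
  · obtain ⟨ρ, hρ, hρX⟩ := hX
    obtain ⟨⟨σ, p⟩, h₁, -, -⟩ := (hsR _ _).1 hρ
    obtain rfl : encode σ = x := h₁
    obtain ⟨p, hp, -⟩ := (hg σ X).1 ⟨ρ, hρ, hρX⟩
    have hsub : effOpen (g (encode σ)) ⊆ yieldSet Ψ p.2 := fun Y hY => by
      obtain ⟨p', hp', hY'⟩ := (hg σ Y).1 hY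
      rwa [Part.mem_unique hp hp']
    refine (measure_mono hsub).trans
      ((lebesgue_yieldSet_le (Nat.two_pow_pos _) (hsmall σ p hp)).trans_eq ?_)
    rw [Nat.cast_pow, Nat.cast_ofNat, ENNReal.inv_pow]

theorem computable_of_reducible {X G Z : Cantor} (hX : IsDemuthRandom X) (hG : IsPbGeneric G)
    (hZX : Reducible Z X) (hZG : Reducible Z G) : Computable Z := by
  obtain ⟨Ψ, hΨ⟩ := (OracleCode.exists_eval_iff _ _).2 hZX
  obtain ⟨Γ, hΓ⟩ := (OracleCode.exists_eval_iff _ _).2 hZG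
  by_contra hZ
  obtain ⟨F, q, u, hF, hq, hu, hqu, hfam, hdom, hext⟩ := exists_small_extension Γ Ψ
  obtain ⟨f, hf, hf₁, hf₂⟩ := exists_pbComputable_extension hF hq hu hqu hdom
  obtain ⟨g, hg, hgX⟩ := exists_demuthTest hF hu fun σ p hp => (hext σ p hp).2
  have hinj : Function.Injective fun n => encode (restr G n) := fun n m h => by
    simpa using congrArg List.length (encode_injective h)
  -- Different `n` give different levels `encode (restr G n)`, so finitely many captures of `X`
  -- allow only finitely many `n` at which `G` meets `f`.
  refine hG f hf hf₁ (((hX g hg).preimage hinj.injOn).subset fun n hn => ?_)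
  obtain ⟨fam, hlen, hy, hinc⟩ :=
    exists_splitting_family hΓ hZ (2 ^ encode (restr G n) + 1) n
  obtain ⟨p, hp, hfp⟩ := hf₂ (restr G n) (hfam _ ⟨fam, hlen, fun p hp => (hy p hp).1, hinc⟩)
  refine hgX _ p hp ?_
  have hpΓ := (hext _ p hp).1
  change IsPrefixOf _ G at hn
  rw [hfp] at hn
  rw [← hn] at hpΓ
  obtain ⟨k, hk, hk'⟩ := ((Yields.eventually_restr hΓ p.2.length).and
    (Filter.eventually_ge_atTop _)).exists
  -- The chosen extension is a prefix of `G`, so its `Γ`-image agrees with `Z`; `Ψ` computes that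
  -- image from `X` as well.
  have hpZ : restr Z p.2.length = p.2 := List.ext_getElem (by simp) fun i h₁ h₂ =>
    hk.agree (hpΓ.restr_mono hk') h₁ h₂
  obtain ⟨l, hl⟩ := (Yields.eventually_restr hΨ p.2.length).exists
  exact ⟨l, hpZ ▸ hl⟩

end MinPair

theorem mainTheorem3 (X G : MinPair.Cantor) (hX : MinPair.IsDemuthRandom X)
    (hG : MinPair.IsPbGeneric G) : MinPair.IsMinimalPair X G :=
  ⟨hX.not_computable, hG.not_computable, fun _ => MinPair.computable_of_reducible hX hG⟩
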